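/- Let $H$ be a separable complex Hilbert space and let $S,T\subseteq H$ be closed subspaces. Write $P_V$ for the orthogonal projection of $H$ onto a closed subspace $V$, $N(\cdot)$ for the nullspace of an operator, and $\dim V\in\{0,1,2,\dots\}\cup\{\infty\}$ for the Hilbert space dimension of a closed subspace $V$. Say that $S$ and $T$ have a common complement if there is a closed subspace $Z\subseteq H$ such that $H$ is the (not necessarily orthogonal) direct sum of $S$ and $Z$ and also the direct sum of $T$ and $Z$. Put $A=P_S-P_T$. (a) $S$ and $T$ have no common complement if and only if both of the following hold: (1) $\dim N(A-1)\neq\dim N(A+1)$; (2) the restriction of $A$ to $\left(N(A-1)\oplus N(A+1)\right)^{\perp}$ is a compact operator. (b) $S$ and $T$ have no common complement if and only if both of the following hold: (1) $\dim (S\cap T^{\perp})\neq\dim (S^{\perp}\cap T)$; (2) at least one of the operators $P_S P_{T^\perp}$ and $P_T P_{S^\perp}$ is compact on $H$. -/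

import Mathlib

/-- The dimension of a closed subspace of a separable Hilbert space, as an element of
`{0, 1, 2, …} ∪ {∞}` (in a separable space all infinite orthonormal bases are countable, so `∞` is
the only infinite value). -/
noncomputable def hdim {H : Type*} [NormedAddCommGroup H] [InnerProductSpace ℂ H]
    (V : Submodule ℂ H) : ℕ∞ :=
  Cardinal.toENat (Module.rank ℂ V)

/-- `S` and `T` have a common complement: there is a closed subspace `Z` such that `H` is the
(not necessarily orthogonal) direct sum of `S` and `Z`, and also of `T` and `Z`. -/
def HasCommonComplement {H : Type*} [NormedAddCommGroup H] [InnerProductSpace ℂ H]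
    (S T : Submodule ℂ H) : Prop :=
  ∃ Z : Submodule ℂ H, IsClosed (Z : Set H) ∧ IsCompl S Z ∧ IsCompl T Z

/-- The orthogonal projection of the Hilbert space `H` onto a closed subspace, as a bounded operator
on `H`. -/
noncomputable def orthProj {H : Type*} [NormedAddCommGroup H] [InnerProductSpace ℂ H]
    [CompleteSpace H] (S : ClosedSubmodule ℂ H) : H →L[ℂ] H :=
  haveI : CompleteSpace S.toSubmodule := S.isClosed.completeSpace_coe
  S.toSubmodule.starProjection

/-- The operator `A = P_S - P_T`. -/
noncomputable def projDiff {H : Type*} [NormedAddCommGroup H] [InnerProductSpace ℂ H]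
    [CompleteSpace H] (S T : ClosedSubmodule ℂ H) : H →L[ℂ] H :=
  orthProj S - orthProj T

/-- The subspace `(N(A - 1) ⊕ N(A + 1))ᗮ`. -/
noncomputable def eigenCompl {H : Type*} [NormedAddCommGroup H] [InnerProductSpace ℂ H]
    (A : H →L[ℂ] H) : Submodule ℂ H :=
  ((A - 1).ker ⊔ (A + 1).ker)ᗮ

/-!
Write `A = P_S - P_T`. The square `A²` commutes with both `P_S` and `P_T`, so for `0 < ε ≤ 1` the
spectral subspace `L` of `|A|` for `[ε, ∞)` reduces `S` and `T`; it contains `S ∩ Tᗮ` and `Sᗮ ∩ T`.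
On `Lᗮ` the two subspaces are in generic position, and the negative spectral subspace of
`P_S + P_T - 1` is a complement of both. On `L` the operator `A` is bounded below, hence invertible,
so `S ∩ L` and `T ∩ L` are complementary there; if they have the same dimension, the graph of the
negative of an isomorphism between them is a complement of both. For `ε = 1` these parts are
`S ∩ Tᗮ` and `T ∩ Sᗮ`. If `A` is not compact on `W = (S ∩ Tᗮ ⊕ Sᗮ ∩ T)ᗮ`, then `W ∩ L` is
infinite-dimensional for some `ε < 1`, which forces both parts to be infinite-dimensional.

Conversely, let `Z` be a common complement and let `P_S P_{Tᗮ}` be compact. The projection onto `T`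
along `Z` restricts to an isomorphism `S ≃ T`, and it differs on `S` from `P_T` by a compact
operator. Hence `P_T : S → T` has index zero, and its kernel and the orthogonal complement of its
range are `S ∩ Tᗮ` and `T ∩ Sᗮ`.
-/

universe u

section CompactOperators

variable {𝕜 X Y : Type*} [RCLike 𝕜]

theorem isCompactOperator_comp_of_finiteDimensional {V : Type*}
    [NormedAddCommGroup X] [NormedSpace 𝕜 X] [NormedAddCommGroup Y] [NormedSpace 𝕜 Y]
    [NormedAddCommGroup V] [NormedSpace 𝕜 V] [FiniteDimensional 𝕜 V]
    (g : V →L[𝕜] Y) (f : X →L[𝕜] V) : IsCompactOperator (g ∘L f) := by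
  have : LocallyCompactSpace V := .of_finiteDimensional_of_complete 𝕜 V
  exact (isCompactOperator_of_locallyCompactSpace_dom f).clm_comp g

theorem surjective_equiv_sub_of_injective
    [NormedAddCommGroup X] [NormedSpace 𝕜 X] [CompleteSpace X]
    [NormedAddCommGroup Y] [NormedSpace 𝕜 Y] (e : X ≃L[𝕜] Y) {K : X →L[𝕜] Y}
    (hK : IsCompactOperator K) (hinj : Function.Injective ((e : X →L[𝕜] Y) - K)) :
    Function.Surjective ((e : X →L[𝕜] Y) - K) := by
  have hcompact : IsCompactOperator ((e.symm : Y →L[𝕜] X) ∘L K) :=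
    hK.clm_comp (e.symm : Y →L[𝕜] X)
  have hfactor : (e : X →L[𝕜] Y) - K = (e : X →L[𝕜] Y) ∘L (1 - (e.symm : Y →L[𝕜] X) ∘L K) := by
    ext x
    simp
  rw [hfactor] at hinj ⊢
  refine e.surjective.comp ?_
  rcases hcompact.hasEigenvalue_or_mem_resolventSet one_ne_zero with heig | hres
  · obtain ⟨v, hv⟩ := heig.exists_hasEigenvector
    have hKv : e.symm (K v) = v := by simpa using hv.apply_eq_smul
    refine absurd (hinj (a₂ := 0) ?_) hv.2
    simp [hKv]
  · rw [spectrum.mem_resolventSet_iff, map_one] at hres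
    exact (ContinuousLinearMap.isUnit_iff_bijective.1 hres).2

variable [NormedAddCommGroup X] [InnerProductSpace 𝕜 X]
  [NormedAddCommGroup Y] [InnerProductSpace 𝕜 Y]

theorem norm_sub_starProjection_le (V : Submodule 𝕜 X) [V.HasOrthogonalProjection]
    (x : X) {v : X} (hv : v ∈ V) : ‖x - V.starProjection x‖ ≤ ‖x - v‖ := by
  rw [Submodule.starProjection_minimal]
  exact ciInf_le ⟨0, Set.forall_mem_range.mpr fun _ => norm_nonneg _⟩ (⟨v, hv⟩ : V)

theorem exists_finiteDimensional_norm_sub_starProjection_comp_le {K : X →L[𝕜] Y}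
    (hK : IsCompactOperator K) {ε : ℝ} (hε : 0 < ε) :
    ∃ (V : Submodule 𝕜 Y) (_ : FiniteDimensional 𝕜 V), ‖K - V.starProjection ∘L K‖ ≤ ε := by
  have htb : TotallyBounded (K '' Metric.closedBall 0 1) :=
    (hK.isCompact_closure_image_closedBall (f := (K : X →ₗ[𝕜] Y)) 1).totallyBounded.subset
      subset_closure
  obtain ⟨t, ht, hcover⟩ := Metric.totallyBounded_iff.1 htb ε hε
  have hfin : FiniteDimensional 𝕜 (Submodule.span 𝕜 t) := FiniteDimensional.span_of_finite 𝕜 ht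
  refine ⟨Submodule.span 𝕜 t, hfin, ContinuousLinearMap.opNorm_le_of_unit_norm hε.le fun x hx => ?_⟩
  obtain ⟨y, hy, hxy⟩ := Set.mem_iUnion₂.1
    (hcover (Set.mem_image_of_mem K (mem_closedBall_zero_iff.2 hx.le)))
  calc ‖K x - (Submodule.span 𝕜 t).starProjection (K x)‖
      ≤ ‖K x - y‖ := norm_sub_starProjection_le _ _ (Submodule.subset_span hy)
    _ ≤ ε := (mem_ball_iff_norm.1 hxy).le

theorem isCompactOperator_adjoint [CompleteSpace X] [CompleteSpace Y] {K : X →L[𝕜] Y}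
    (hK : IsCompactOperator K) : IsCompactOperator (ContinuousLinearMap.adjoint K) := by
  have hclosed := isClosed_setOfPred_isCompactOperator (σ₁₂ := RingHom.id 𝕜) (M₁ := Y) (M₂ := X)
  refine hclosed.closure_subset (Metric.mem_closure_iff.2 fun ε hε => ?_)
  obtain ⟨V, _, hV⟩ := exists_finiteDimensional_norm_sub_starProjection_comp_le hK (half_pos hε)
  refine ⟨ContinuousLinearMap.adjoint (V.starProjection ∘L K), ?_, ?_⟩
  · rw [ContinuousLinearMap.adjoint_comp, (isSelfAdjoint_starProjection V).adjoint_eq]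
    exact isCompactOperator_comp_of_finiteDimensional
      (ContinuousLinearMap.adjoint K ∘L V.subtypeL) V.orthogonalProjectionOnto
  · rw [dist_eq_norm, ← map_sub, LinearIsometryEquiv.norm_map]
    linarith

end CompactOperators

section Index

open Module

variable {𝕜 : Type*} {X Y : Type u} [RCLike 𝕜] [NormedAddCommGroup X] [InnerProductSpace 𝕜 X]
  [NormedAddCommGroup Y] [InnerProductSpace 𝕜 Y]

theorem injective_add_comp_orthogonalProjectionOnto_ker {F : X →L[𝕜] Y}
    [F.ker.HasOrthogonalProjection] {φ : F.ker →L[𝕜] F.rangeᗮ} (hφ : Function.Injective φ) :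
    Function.Injective (F + F.rangeᗮ.subtypeL ∘L φ ∘L F.ker.orthogonalProjectionOnto) := by
  refine (injective_iff_map_eq_zero _).2 fun x hx => ?_
  set n := F.ker.orthogonalProjectionOnto x
  have hsum : F x + φ n = 0 := hx
  have hFx : F x = 0 := by
    have horth : inner 𝕜 (F x) (φ n : Y) = 0 := (φ n).2 _ ⟨x, rfl⟩
    rwa [eq_neg_of_add_eq_zero_right hsum, inner_neg_right, neg_eq_zero, inner_self_eq_zero]
      at horth
  have hn : n = 0 := hφ (by simpa [hFx] using hsum)
  calc x = F.ker.starProjection x := (Submodule.starProjection_eq_self_iff.2 hFx).symm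
    _ = 0 := congrArg Subtype.val hn

theorem surjective_of_surjective_add_comp_orthogonalProjectionOnto_ker {F : X →L[𝕜] Y}
    [F.ker.HasOrthogonalProjection] {φ : F.ker →L[𝕜] F.rangeᗮ}
    (h : Function.Surjective (F + F.rangeᗮ.subtypeL ∘L φ ∘L F.ker.orthogonalProjectionOnto)) :
    Function.Surjective φ := by
  intro y
  obtain ⟨x, hx⟩ := h y
  set n := F.ker.orthogonalProjectionOnto x
  have hsum : F x + φ n = y := hx
  have hFx : F x = 0 := by
    have horth : inner 𝕜 (F x) ((y - φ n : F.rangeᗮ) : Y) = 0 := (y - φ n).2 _ ⟨x, rfl⟩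
    rwa [Submodule.coe_sub, ← hsum, add_sub_cancel_right, inner_self_eq_zero] at horth
  exact ⟨n, Subtype.ext (by simpa [hFx] using hsum)⟩

variable [CompleteSpace X]

theorem finiteDimensional_ker_equiv_sub (e : X ≃L[𝕜] Y) {K : X →L[𝕜] Y}
    (hK : IsCompactOperator K) : FiniteDimensional 𝕜 ((e : X →L[𝕜] Y) - K).ker := by
  have hcompact : IsCompactOperator ((e.symm : Y →L[𝕜] X) ∘L K) :=
    hK.clm_comp (e.symm : Y →L[𝕜] X)
  have hker : ((e : X →L[𝕜] Y) - K).ker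
      = End.eigenspace (((e.symm : Y →L[𝕜] X) ∘L K : X →L[𝕜] X) : X →ₗ[𝕜] X) 1 := by
    ext x
    simp [sub_eq_zero, e.symm_apply_eq, eq_comm (a := K x)]
  rw [hker]
  exact ContinuousLinearMap.finite_dimensional_eigenspace hcompact 1 one_ne_zero

theorem rank_orthogonal_range_equiv_sub_le (e : X ≃L[𝕜] Y) {K : X →L[𝕜] Y}
    (hK : IsCompactOperator K) :
    Module.rank 𝕜 ((e : X →L[𝕜] Y) - K).rangeᗮ ≤ Module.rank 𝕜 ((e : X →L[𝕜] Y) - K).ker := by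
  set F := (e : X →L[𝕜] Y) - K
  -- Adding to `F` a finite-rank embedding of its kernel into its larger cokernel would make it
  -- injective but not surjective, which the Fredholm alternative forbids.
  by_contra! hlt
  obtain ⟨φ₀, hφ₀⟩ := Module.Free.exists_linearMap_injective_of_rank_lt hlt
  have : FiniteDimensional 𝕜 F.ker := finiteDimensional_ker_equiv_sub e hK
  let φ : F.ker →L[𝕜] F.rangeᗮ := LinearMap.toContinuousLinearMap φ₀
  let G := F.rangeᗮ.subtypeL ∘L φ ∘L F.ker.orthogonalProjectionOnto
  have hG : IsCompactOperator G := isCompactOperator_comp_of_finiteDimensional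
    (F.rangeᗮ.subtypeL ∘L φ) F.ker.orthogonalProjectionOnto
  have hFG : F + G = (e : X →L[𝕜] Y) - (K - G) := by
    rw [sub_sub_eq_add_sub, add_sub_right_comm]
  have hinj : Function.Injective (F + G) :=
    injective_add_comp_orthogonalProjectionOnto_ker (φ := φ) hφ₀
  have hsurj : Function.Surjective (F + G) :=
    hFG ▸ surjective_equiv_sub_of_injective e (hK.sub hG) (hFG ▸ hinj)
  have hφ : Function.Surjective φ :=
    surjective_of_surjective_add_comp_orthogonalProjectionOnto_ker hsurj
  exact hlt.not_ge (LinearMap.rank_le_of_surjective φ₀ hφ)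

theorem rank_ker_equiv_sub_eq [CompleteSpace Y] (e : X ≃L[𝕜] Y) {K : X →L[𝕜] Y}
    (hK : IsCompactOperator K) :
    Module.rank 𝕜 ((e : X →L[𝕜] Y) - K).ker = Module.rank 𝕜 ((e : X →L[𝕜] Y) - K).rangeᗮ := by
  refine le_antisymm ?_ (rank_orthogonal_range_equiv_sub_le e hK)
  let e' : Y ≃L[𝕜] X := .equivOfInverse (ContinuousLinearMap.adjoint (e : X →L[𝕜] Y))
    (ContinuousLinearMap.adjoint (e.symm : Y →L[𝕜] X))
    (fun y => by simp [← ContinuousLinearMap.comp_apply, ← ContinuousLinearMap.adjoint_comp,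
      ContinuousLinearMap.adjoint_id])
    (fun x => by simp [← ContinuousLinearMap.comp_apply, ← ContinuousLinearMap.adjoint_comp,
      ContinuousLinearMap.adjoint_id])
  have hle := rank_orthogonal_range_equiv_sub_le e' (isCompactOperator_adjoint hK)
  have hadj : (e' : Y →L[𝕜] X) - ContinuousLinearMap.adjoint K
      = ContinuousLinearMap.adjoint ((e : X →L[𝕜] Y) - K) := (map_sub _ _ _).symm
  rwa [hadj, ContinuousLinearMap.orthogonal_range, ContinuousLinearMap.adjoint_adjoint,
    ← ContinuousLinearMap.orthogonal_range] at hle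

end Index

section SeparableHilbert

open Module TopologicalSpace

variable {𝕜 X : Type*} [RCLike 𝕜] [NormedAddCommGroup X] [InnerProductSpace 𝕜 X]

theorem countable_of_orthonormal [SeparableSpace X] {ι : Type*} {v : ι → X}
    (hv : Orthonormal 𝕜 v) : Countable ι := by
  refine Pairwise.countable_of_isOpen_disjoint (s := fun i => Metric.ball (v i) (1 / 2))
    (fun i j hij => Metric.ball_disjoint_ball ?_) (fun i => Metric.isOpen_ball)
    (fun i => ⟨v i, Metric.mem_ball_self (by norm_num)⟩)
  have hsq : ‖v i - v j‖ ^ 2 = 2 := by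
    rw [@norm_sub_sq 𝕜, hv.1, hv.1, hv.2 hij]
    norm_num
  rw [dist_eq_norm]
  nlinarith [norm_nonneg (v i - v j)]

theorem exists_hilbertBasis_nat [CompleteSpace X] [SeparableSpace X]
    (h : ¬ FiniteDimensional 𝕜 X) : Nonempty (HilbertBasis ℕ 𝕜 X) := by
  obtain ⟨w, b, -⟩ := exists_hilbertBasis 𝕜 X
  have : Countable w := countable_of_orthonormal b.orthonormal
  have : Infinite w := by
    by_contra hfin
    rw [not_infinite_iff_finite] at hfin
    have := Fintype.ofFinite w
    exact h (Module.Finite.of_basis b.toOrthonormalBasis.toBasis)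
  obtain ⟨e⟩ : Nonempty (ℕ ≃ w) := nonempty_equiv_of_countable
  refine ⟨HilbertBasis.mk (v := b ∘ e) (b.orthonormal.comp e e.injective) ?_⟩
  rw [e.surjective.range_comp]
  exact b.dense_span.ge

end SeparableHilbert

section HDim

open Module TopologicalSpace

variable {X Y : Type*} [NormedAddCommGroup X] [InnerProductSpace ℂ X]
  [NormedAddCommGroup Y] [InnerProductSpace ℂ Y]

theorem hdim_eq_top_iff {V : Submodule ℂ X} : hdim V = ⊤ ↔ ¬ FiniteDimensional ℂ V := by
  rw [hdim, Cardinal.toENat_eq_top, ← not_lt, Module.rank_lt_aleph0_iff]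

theorem hdim_comap_subtype (L S : Submodule ℂ X) : hdim (S.comap L.subtype) = hdim (S ⊓ L) := by
  rw [hdim, (Submodule.equivSubtypeMap L (S.comap L.subtype)).rank_eq,
    Submodule.map_comap_subtype, inf_comm, hdim]

theorem nonempty_continuousLinearEquiv_of_hdim_eq [SeparableSpace X] [SeparableSpace Y]
    {V : Submodule ℂ X} {W : Submodule ℂ Y} [CompleteSpace V] [CompleteSpace W]
    (h : hdim V = hdim W) : Nonempty (V ≃L[ℂ] W) := by
  have : SecondCountableTopology X := UniformSpace.secondCountable_of_separable X
  have : SecondCountableTopology Y := UniformSpace.secondCountable_of_separable Y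
  have hfin : FiniteDimensional ℂ V ↔ FiniteDimensional ℂ W := by
    rw [← not_iff_not, ← hdim_eq_top_iff, h, hdim_eq_top_iff]
  by_cases hV : FiniteDimensional ℂ V
  · have hW : FiniteDimensional ℂ W := hfin.1 hV
    refine ⟨ContinuousLinearEquiv.ofFinrankEq ?_⟩
    rw [hdim, hdim, ← finrank_eq_rank, ← finrank_eq_rank] at h
    simpa only [map_natCast, Nat.cast_inj] using h
  · obtain ⟨b⟩ := exists_hilbertBasis_nat hV
    obtain ⟨c⟩ := exists_hilbertBasis_nat (hfin.not.1 hV)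
    exact ⟨(b.repr.trans c.repr.symm).toContinuousLinearEquiv⟩

end HDim

section IdempotentPairs

variable {R : Type*} [Ring R] {p q : R}

theorem commute_sub_sq_left (hp : IsIdempotentElem p) (hq : IsIdempotentElem q) :
    Commute ((p - q) ^ 2) p := by
  have hpp : ∀ a, p * (p * a) = p * a := fun a => by rw [← mul_assoc, hp]
  simp only [commute_iff_eq, sq, mul_sub, sub_mul, mul_assoc, hp.eq, hq.eq, hpp]
  abel

theorem commute_sub_sq_right (hp : IsIdempotentElem p) (hq : IsIdempotentElem q) :
    Commute ((p - q) ^ 2) q := by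
  rw [← neg_sub, neg_sq]
  exact commute_sub_sq_left hq hp

theorem sub_sq_add_add_sub_one_sq (hp : IsIdempotentElem p) (hq : IsIdempotentElem q) :
    (p - q) ^ 2 + (p + q - 1) ^ 2 = 1 := by
  simp only [sq, mul_sub, sub_mul, mul_add, add_mul, mul_one, one_mul, hp.eq, hq.eq]
  abel

theorem mul_add_mul_eq_add_sq (hp : IsIdempotentElem p) (hq : IsIdempotentElem q) :
    p * (p + q - 1) + (p + q - 1) * p = (p + q - 1) + (p + q - 1) ^ 2 := by
  simp only [sq, mul_sub, sub_mul, mul_add, add_mul, mul_one, one_mul, hp.eq, hq.eq]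
  abel

theorem mul_two_mul_add_sub_one_sq {u m b : R} (hp : IsIdempotentElem p) (hu : IsIdempotentElem u)
    (hmp : Commute m p) (hm : m ^ 2 = b ^ 2) (hmu : 2 * (m * u) = m + b)
    (hpb : p * b + b * p = b + b ^ 2) : m * (2 * (p + u - 1) ^ 2) = m * (1 + m) := by
  have hexpand : (p + u - 1) ^ 2 = p * u + u * p - p - u + 1 := by
    simp only [sq, mul_sub, sub_mul, mul_add, add_mul, mul_one, one_mul, hp.eq, hu.eq]
    abel
  calc m * (2 * (p + u - 1) ^ 2)
      = 2 * (m * p * u) + 2 * (m * u) * p - 2 * (m * p) - 2 * (m * u) + 2 * m := by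
        rw [hexpand, two_mul]
        simp only [two_mul, mul_sub, mul_add, add_mul, mul_one, mul_assoc]
        abel
    _ = p * (2 * (m * u)) + 2 * (m * u) * p - 2 * (p * m) - 2 * (m * u) + 2 * m := by
        rw [hmp.eq, mul_assoc p, two_mul, ← mul_add, ← two_mul (m * u)]
    _ = (p * b + b * p) - b + m := by
        rw [hmu, add_mul, hmp.eq, mul_add, two_mul, two_mul]
        abel
    _ = m * (1 + m) := by
        rw [hpb, ← hm, mul_add, mul_one, sq]
        abel

end IdempotentPairs

section SelfAdjoint

variable {𝕜 X : Type*} [RCLike 𝕜] [NormedAddCommGroup X] [InnerProductSpace 𝕜 X]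

theorem apply_mem_of_commute_starProjection {V : Submodule 𝕜 X} [V.HasOrthogonalProjection]
    {f : X →L[𝕜] X} (h : Commute f V.starProjection) {x : X} (hx : x ∈ V) : f x ∈ V := by
  have hfx := DFunLike.congr_fun h.eq x
  simp only [mul_apply_eq_comp, Submodule.starProjection_eq_self_iff.2 hx] at hfx
  rw [hfx]
  exact Submodule.starProjection_apply_mem V _

theorem starProjection_mem_orthogonal_of_le {M L : Submodule 𝕜 X} [L.HasOrthogonalProjection]
    (hML : M ≤ L) {x : X} (hx : x ∈ Mᗮ) : L.starProjection x ∈ Mᗮ := by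
  intro u hu
  rw [← Submodule.inner_starProjection_left_eq_right,
    Submodule.starProjection_eq_self_iff.2 (hML hu)]
  exact hx u hu

variable [CompleteSpace X]

theorem commute_starProjection_of_isSelfAdjoint {C : X →L[𝕜] X} (hC : IsSelfAdjoint C)
    {V : Submodule 𝕜 X} [V.HasOrthogonalProjection] (hV : ∀ x ∈ V, C x ∈ V) :
    Commute V.starProjection C := by
  ext x
  refine Submodule.eq_starProjection_of_mem_orthogonal
    (hV _ (Submodule.starProjection_apply_mem V x)) fun v hv => ?_
  change inner 𝕜 v (C x - C (V.starProjection x)) = 0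
  rw [← map_sub, ← hC.isSymmetric.apply_clm]
  exact Submodule.sub_starProjection_mem_orthogonal x _ (hV v hv)

end SelfAdjoint

section NonnegSpace

open ContinuousLinearMap

variable {X : Type*} [NormedAddCommGroup X] [InnerProductSpace ℂ X] [CompleteSpace X]
  {C D : X →L[ℂ] X}

/-- The spectral subspace of a self-adjoint operator `D` for the interval `[0, ∞)`, obtained as the
kernel of the negative part of `D` in order to avoid the spectral theorem. -/
noncomputable def nonnegSpace (D : X →L[ℂ] X) : Submodule ℂ X := (D⁻).ker

instance (D : X →L[ℂ] X) : CompleteSpace (nonnegSpace D) :=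
  (isClosed_ker D⁻).completeSpace_coe

theorem starProjection_nonnegSpace_mul_posPart (D : X →L[ℂ] X) :
    (nonnegSpace D).starProjection * D⁺ = D⁺ := by
  ext x
  exact Submodule.starProjection_eq_self_iff.2
    (DFunLike.congr_fun (CFC.negPart_mul_posPart D) x : D⁻ (D⁺ x) = 0)

theorem negPart_mul_starProjection_nonnegSpace (D : X →L[ℂ] X) :
    D⁻ * (nonnegSpace D).starProjection = 0 := by
  ext x
  exact Submodule.starProjection_apply_mem (nonnegSpace D) x

theorem posPart_mul_starProjection_nonnegSpace (D : X →L[ℂ] X) :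
    D⁺ * (nonnegSpace D).starProjection = D⁺ := by
  simpa [(isSelfAdjoint_starProjection _).star_eq, (CFC.posPart_nonneg D).isSelfAdjoint.star_eq]
    using congrArg star (starProjection_nonnegSpace_mul_posPart D)

theorem abs_mul_starProjection_nonnegSpace (hD : IsSelfAdjoint D) :
    CFC.abs D * (nonnegSpace D).starProjection = D⁺ := by
  rw [← CFC.posPart_add_negPart D hD, add_mul, posPart_mul_starProjection_nonnegSpace,
    negPart_mul_starProjection_nonnegSpace, add_zero]

theorem mul_starProjection_nonnegSpace (hD : IsSelfAdjoint D) :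
    D * (nonnegSpace D).starProjection = D⁺ := by
  nth_rw 1 [← CFC.posPart_sub_negPart D hD]
  rw [sub_mul, posPart_mul_starProjection_nonnegSpace, negPart_mul_starProjection_nonnegSpace,
    sub_zero]

theorem re_inner_nonneg_of_mem_nonnegSpace (hD : IsSelfAdjoint D) {x : X}
    (hx : x ∈ nonnegSpace D) : 0 ≤ RCLike.re (inner ℂ (D x) x) := by
  have hDx : D x = D⁺ x := by
    rw [← mul_starProjection_nonnegSpace hD, mul_apply_eq_comp,
      Submodule.starProjection_eq_self_iff.2 hx]
  rw [hDx]
  exact ((nonneg_iff_isPositive _).1 (CFC.posPart_nonneg D)).re_inner_nonneg_left x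

theorem re_inner_nonpos_of_mem_orthogonal_nonnegSpace (hD : IsSelfAdjoint D) {x : X}
    (hx : x ∈ (nonnegSpace D)ᗮ) : RCLike.re (inner ℂ (D x) x) ≤ 0 := by
  have hpos : D⁺ x = 0 := by
    rw [← mul_starProjection_nonnegSpace hD, mul_apply_eq_comp,
      (Submodule.starProjection_apply_eq_zero_iff _).2 hx, map_zero]
  have hDx : D x = -D⁻ x := by
    rw [← zero_sub, ← hpos, ← sub_apply, CFC.posPart_sub_negPart D hD]
  rw [hDx, inner_neg_left, map_neg, neg_nonpos]
  exact ((nonneg_iff_isPositive _).1 (CFC.negPart_nonneg D)).re_inner_nonneg_left x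

theorem mem_nonnegSpace_of_apply_eq_smul (hD : IsSelfAdjoint D) {x : X} {r : ℝ} (hr : 0 ≤ r)
    (hx : D x = (r : ℂ) • x) : x ∈ nonnegSpace D := by
  have hmul : D⁻ * D = -(D⁻ * D⁻) := by
    nth_rw 2 [← CFC.posPart_sub_negPart D hD]
    rw [mul_sub, CFC.negPart_mul_posPart, zero_sub]
  have happly : D⁻ (D⁻ x) = -((r : ℂ) • D⁻ x) := by
    rw [← map_smul, ← hx, ← mul_apply_eq_comp, ← mul_apply_eq_comp, hmul, neg_apply, neg_neg]
  have hneg := (nonneg_iff_isPositive _).1 (CFC.negPart_nonneg D)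
  have hnorm : ‖D⁻ x‖ ^ 2 = -(r * RCLike.re (inner ℂ (D⁻ x) x)) := by
    rw [← inner_self_eq_norm_sq (𝕜 := ℂ), ← hneg.isSymmetric.apply_clm, happly, inner_neg_left,
      map_neg, inner_smul_left, Complex.conj_ofReal, ← Complex.coe_algebraMap,
      RCLike.re_ofReal_mul]
  have hle : ‖D⁻ x‖ ^ 2 ≤ 0 :=
    hnorm.trans_le (neg_nonpos.2 (mul_nonneg hr (hneg.re_inner_nonneg_left x)))
  exact norm_eq_zero.1 (sq_eq_zero_iff.1 (le_antisymm hle (sq_nonneg _)))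

theorem commute_starProjection_nonnegSpace (hC : IsSelfAdjoint C) (h : Commute D C) :
    Commute (nonnegSpace D).starProjection C := by
  refine commute_starProjection_of_isSelfAdjoint hC fun x hx => ?_
  have hcomm : Commute D⁻ C := h.cfcₙ_real _
  calc D⁻ (C x) = C (D⁻ x) := DFunLike.congr_fun hcomm.eq x
    _ = 0 := by rw [show D⁻ x = 0 from hx, map_zero]

end NonnegSpace

section AbsGeSpace

open ContinuousLinearMap

variable {X : Type*} [NormedAddCommGroup X] [InnerProductSpace ℂ X] [CompleteSpace X]
  {A C : X →L[ℂ] X} {ε : ℝ} {x : X}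

/-- The spectral subspace of `|A|` for the interval `[ε, ∞)`, where `A` is self-adjoint and
`0 ≤ ε`. -/
noncomputable def absGeSpace (A : X →L[ℂ] X) (ε : ℝ) : Submodule ℂ X :=
  nonnegSpace (A ^ 2 - algebraMap ℝ (X →L[ℂ] X) (ε ^ 2))

noncomputable instance (A : X →L[ℂ] X) (ε : ℝ) : CompleteSpace (absGeSpace A ε) :=
  inferInstanceAs (CompleteSpace (nonnegSpace _))

theorem isSelfAdjoint_sq_sub_algebraMap (hA : IsSelfAdjoint A) (r : ℝ) :
    IsSelfAdjoint (A ^ 2 - algebraMap ℝ (X →L[ℂ] X) r) :=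
  (hA.pow 2).sub (.algebraMap _ (.all r))

theorem re_inner_sq_sub_algebraMap (hA : IsSelfAdjoint A) (ε : ℝ) (x : X) :
    RCLike.re (inner ℂ ((A ^ 2 - algebraMap ℝ (X →L[ℂ] X) (ε ^ 2)) x) x)
      = ‖A x‖ ^ 2 - (ε * ‖x‖) ^ 2 := by
  have hsq : inner ℂ ((A ^ 2) x) x = inner ℂ (A x) (A x) := by
    rw [sq]
    exact hA.isSymmetric (A x) x
  have hε : (algebraMap ℝ (X →L[ℂ] X) (ε ^ 2)) x = ((ε ^ 2 : ℝ) : ℂ) • x := rfl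
  rw [sub_apply, inner_sub_left, map_sub, hsq, inner_self_eq_norm_sq, hε, inner_smul_left,
    Complex.conj_ofReal, ← Complex.coe_algebraMap, RCLike.re_ofReal_mul, inner_self_eq_norm_sq,
    mul_pow]

theorem mul_norm_le_norm_apply_of_mem_absGeSpace (hA : IsSelfAdjoint A)
    (hx : x ∈ absGeSpace A ε) : ε * ‖x‖ ≤ ‖A x‖ := by
  have hsq := re_inner_nonneg_of_mem_nonnegSpace (isSelfAdjoint_sq_sub_algebraMap hA _) hx
  rw [re_inner_sq_sub_algebraMap hA, sub_nonneg] at hsq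
  exact le_of_sq_le_sq hsq (norm_nonneg _)

theorem norm_apply_le_of_mem_orthogonal_absGeSpace (hA : IsSelfAdjoint A) (hε : 0 ≤ ε)
    (hx : x ∈ (absGeSpace A ε)ᗮ) : ‖A x‖ ≤ ε * ‖x‖ := by
  have hsq := re_inner_nonpos_of_mem_orthogonal_nonnegSpace
    (isSelfAdjoint_sq_sub_algebraMap hA _) hx
  rw [re_inner_sq_sub_algebraMap hA, sub_nonpos] at hsq
  exact le_of_sq_le_sq hsq (by positivity)

theorem norm_comp_starProjection_orthogonal_absGeSpace_le (hA : IsSelfAdjoint A) (hε : 0 ≤ ε) :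
    ‖A ∘L (absGeSpace A ε)ᗮ.starProjection‖ ≤ ε := by
  refine opNorm_le_bound _ hε fun x => ?_
  calc ‖A ((absGeSpace A ε)ᗮ.starProjection x)‖
      ≤ ε * ‖(absGeSpace A ε)ᗮ.starProjection x‖ :=
        norm_apply_le_of_mem_orthogonal_absGeSpace hA hε (Submodule.starProjection_apply_mem _ _)
    _ ≤ ε * ‖x‖ := by gcongr; exact Submodule.norm_starProjection_apply_le _ _

theorem mem_absGeSpace_of_apply_eq_smul (hA : IsSelfAdjoint A) {r : ℝ} (hr : ε ^ 2 ≤ r ^ 2)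
    (hx : A x = (r : ℂ) • x) : x ∈ absGeSpace A ε := by
  refine mem_nonnegSpace_of_apply_eq_smul (isSelfAdjoint_sq_sub_algebraMap hA _)
    (sub_nonneg.2 hr) ?_
  have hε : (algebraMap ℝ (X →L[ℂ] X) (ε ^ 2)) x = ((ε ^ 2 : ℝ) : ℂ) • x := rfl
  rw [sub_apply, sq A, mul_apply_eq_comp, hx, map_smul, hx, hε, smul_smul, ← sub_smul]
  push_cast
  rw [sq (r : ℂ)]

theorem commute_starProjection_absGeSpace (hC : IsSelfAdjoint C) (h : Commute (A ^ 2) C) :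
    Commute (absGeSpace A ε).starProjection C :=
  commute_starProjection_nonnegSpace hC (h.sub_left (Algebra.commute_algebraMap_left _ _))

theorem isCompactOperator_comp_subtypeL_of_finiteDimensional_inf_absGeSpace
    (hA : IsSelfAdjoint A) {W : Submodule ℂ X}
    (hfin : ∀ ε : ℝ, 0 < ε → ε < 1 → FiniteDimensional ℂ (W ⊓ absGeSpace A ε : Submodule ℂ X))
    (hinv : ∀ ε : ℝ, 0 < ε → ε < 1 → ∀ x ∈ W, (absGeSpace A ε).starProjection x ∈ W) :
    IsCompactOperator (A ∘L W.subtypeL) := by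
  have hclosed := isClosed_setOfPred_isCompactOperator (σ₁₂ := RingHom.id ℂ) (M₁ := W) (M₂ := X)
  refine hclosed.closure_subset (Metric.mem_closure_iff.2 fun δ hδ => ?_)
  obtain ⟨ε, hε, hεlt⟩ := exists_between (lt_min hδ one_pos)
  obtain ⟨hεδ, hε1⟩ := lt_min_iff.1 hεlt
  set V := absGeSpace A ε
  have := hfin ε hε hε1
  let p : W →L[ℂ] (W ⊓ V : Submodule ℂ X) := (V.starProjection ∘L W.subtypeL).codRestrict _
    fun x => ⟨hinv ε hε hε1 x x.2, Submodule.starProjection_apply_mem V _⟩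
  refine ⟨(A ∘L (W ⊓ V).subtypeL) ∘L p, isCompactOperator_comp_of_finiteDimensional _ p, ?_⟩
  have hsub : A ∘L W.subtypeL - (A ∘L (W ⊓ V).subtypeL) ∘L p
      = (A ∘L Vᗮ.starProjection) ∘L W.subtypeL := by
    rw [Submodule.starProjection_orthogonal', comp_sub, sub_comp]
    rfl
  rw [dist_eq_norm, hsub]
  calc ‖(A ∘L Vᗮ.starProjection) ∘L W.subtypeL‖
      ≤ ‖A ∘L Vᗮ.starProjection‖ * ‖W.subtypeL‖ := opNorm_comp_le _ _
    _ ≤ ε * 1 := by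
        gcongr
        · exact norm_comp_starProjection_orthogonal_absGeSpace_le hA hε.le
        · exact Submodule.norm_subtypeL_le W
    _ < δ := by rwa [mul_one]

end AbsGeSpace

section Complementarity

variable {𝕜 X : Type*} [RCLike 𝕜] [NormedAddCommGroup X] [InnerProductSpace 𝕜 X]

theorem isCompl_of_bijective_starProjection_sub {S Z : Submodule 𝕜 X}
    [S.HasOrthogonalProjection] [Z.HasOrthogonalProjection]
    (h : Function.Bijective (S.starProjection - Z.starProjection)) : IsCompl S Z := by
  constructor
  · refine Submodule.disjoint_def.2 fun x hS hZ => h.1 ?_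
    rw [sub_apply, Submodule.starProjection_eq_self_iff.2 hS,
      Submodule.starProjection_eq_self_iff.2 hZ, sub_self, map_zero]
  · rw [codisjoint_iff, eq_top_iff]
    intro x _
    obtain ⟨y, rfl⟩ := h.2 x
    exact Submodule.sub_mem_sup (Submodule.starProjection_apply_mem S y)
      (Submodule.starProjection_apply_mem Z y)

theorem injective_starProjection_add_sub_one {S T : Submodule 𝕜 X}
    [S.HasOrthogonalProjection] [T.HasOrthogonalProjection] (h₁ : S ⊓ Tᗮ = ⊥) (h₂ : Sᗮ ⊓ T = ⊥) :
    Function.Injective (S.starProjection + T.starProjection - 1 : X →L[𝕜] X) := by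
  refine (injective_iff_map_eq_zero _).2 fun x hx => ?_
  have hsum : S.starProjection x + T.starProjection x = x := sub_eq_zero.1 hx
  have hS : S.starProjection x = 0 := by
    rw [← Submodule.mem_bot 𝕜, ← h₁]
    refine ⟨Submodule.starProjection_apply_mem S x, ?_⟩
    rw [eq_sub_of_add_eq hsum]
    exact Submodule.sub_starProjection_mem_orthogonal x
  have hT : T.starProjection x = 0 := by
    rw [← Submodule.mem_bot 𝕜, ← h₂]
    refine ⟨?_, Submodule.starProjection_apply_mem T x⟩
    rw [eq_sub_of_add_eq' hsum]
    exact Submodule.sub_starProjection_mem_orthogonal x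
  rw [← hsum, hS, hT, add_zero]

theorem bijective_of_isSelfAdjoint_of_mul_norm_le [CompleteSpace X] {E : X →L[𝕜] X}
    (hE : IsSelfAdjoint E) {c : ℝ} (hc : 0 < c) (h : ∀ x, c * ‖x‖ ≤ ‖E x‖) :
    Function.Bijective E := by
  have hanti : AntilipschitzWith ⟨c⁻¹, by positivity⟩ E :=
    E.antilipschitz_of_bound fun x => (le_inv_mul_iff₀ hc).2 (h x)
  refine E.bijective_iff_dense_range_and_antilipschitz.2 ⟨?_, _, hanti⟩
  rw [Submodule.topologicalClosure_eq_top_iff, E.orthogonal_range, hE.adjoint_eq]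
  exact LinearMap.ker_eq_bot.2 hanti.injective

end Complementarity

section GenericPosition

open ContinuousLinearMap

variable {X : Type*} [NormedAddCommGroup X] [InnerProductSpace ℂ X] [CompleteSpace X]
  {S T : Submodule ℂ X} [S.HasOrthogonalProjection] [T.HasOrthogonalProjection]

theorem commute_abs_of_commute_sq {b p : X →L[ℂ] X} (hb : IsSelfAdjoint b)
    (h : Commute (b ^ 2) p) : Commute (CFC.abs b) p := by
  rw [CFC.abs, hb.star_eq, ← sq]
  exact h.cfcₙ_nnreal _

theorem injective_abs {b : X →L[ℂ] X} (hb : IsSelfAdjoint b) (hinj : Function.Injective b) :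
    Function.Injective (CFC.abs b : X →L[ℂ] X) := by
  refine (injective_iff_map_eq_zero _).2 fun x hx => ?_
  have hsq : b (b x) = CFC.abs b (CFC.abs b x) := by
    rw [← mul_apply_eq_comp, ← mul_apply_eq_comp, CFC.abs_mul_abs, hb.star_eq]
  rw [hx, map_zero] at hsq
  exact (map_eq_zero_iff _ hinj).1 ((map_eq_zero_iff _ hinj).1 hsq)

theorem isCompl_orthogonal_nonnegSpace
    (hinj : Function.Injective (S.starProjection + T.starProjection - 1 : X →L[ℂ] X)) :
    IsCompl S (nonnegSpace (S.starProjection + T.starProjection - 1))ᗮ := by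
  set P := S.starProjection
  set B := P + T.starProjection - 1
  set U := (nonnegSpace B).starProjection
  have hB : IsSelfAdjoint B := ((isSelfAdjoint_starProjection S).add
    (isSelfAdjoint_starProjection T)).sub (.one _)
  have hP : IsIdempotentElem P := S.isIdempotentElem_starProjection
  have hQ : IsIdempotentElem T.starProjection := T.isIdempotentElem_starProjection
  have hcomm : Commute (CFC.abs B) P := by
    refine commute_abs_of_commute_sq hB ?_
    rw [← sub_eq_of_eq_add' (sub_sq_add_add_sub_one_sq hP hQ).symm]
    exact (Commute.one_left P).sub_left (commute_sub_sq_left hP hQ)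
  have habs_sq : CFC.abs B ^ 2 = B ^ 2 := by rw [sq, CFC.abs_mul_abs, hB.star_eq, sq]
  have habs_mul : 2 * (CFC.abs B * U) = CFC.abs B + B := by
    rw [abs_mul_starProjection_nonnegSpace hB, CFC.abs_add_self B, two_mul, two_smul]
  have hsq : 2 * (P + U - 1) ^ 2 = 1 + CFC.abs B := by
    ext x
    exact injective_abs hB hinj (DFunLike.congr_fun (mul_two_mul_add_sub_one_sq hP
      (nonnegSpace B).isIdempotentElem_starProjection hcomm habs_sq habs_mul
      (mul_add_mul_eq_add_sq hP hQ)) x)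
  have hunit : IsUnit (2 * (P + U - 1) ^ 2) := by
    rw [hsq]
    exact CStarAlgebra.isUnit_of_le 1 (le_add_of_nonneg_right (CFC.abs_nonneg B))
  have hdiff : P - (nonnegSpace B)ᗮ.starProjection = P + U - 1 := by
    rw [Submodule.starProjection_orthogonal', ← sub_add, sub_add_eq_add_sub]
  apply isCompl_of_bijective_starProjection_sub
  rw [hdiff, ← isUnit_iff_bijective, ← isUnit_pow_iff two_ne_zero]
  exact ((Commute.ofNat_left 2 _).isUnit_mul_iff.1 hunit).2

theorem hasCommonComplement_of_inf_orthogonal_eq_bot (h₁ : S ⊓ Tᗮ = ⊥) (h₂ : Sᗮ ⊓ T = ⊥) :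
    HasCommonComplement S T := by
  have hinj := injective_starProjection_add_sub_one h₁ h₂
  refine ⟨_, Submodule.isClosed_orthogonal _, isCompl_orthogonal_nonnegSpace hinj, ?_⟩
  rw [add_comm] at hinj ⊢
  exact isCompl_orthogonal_nonnegSpace hinj

end GenericPosition

section GraphComplement

variable {X : Type*} [NormedAddCommGroup X] [InnerProductSpace ℂ X] [CompleteSpace X]
  {S T : Submodule ℂ X} [CompleteSpace S] [CompleteSpace T]

theorem hasCommonComplement_of_isCompl_of_continuousLinearEquiv (h : IsCompl S T)
    (e : S ≃L[ℂ] T) : HasCommonComplement S T := by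
  have hST := Submodule.IsCompl.isTopCompl_of_isClosed h
    (IsComplete.isClosed (completeSpace_coe_iff_isComplete.1 ‹CompleteSpace S›))
    (IsComplete.isClosed (completeSpace_coe_iff_isComplete.1 ‹CompleteSpace T›))
  let g : X →L[ℂ] T :=
    T.projectionOntoL S hST.symm - (e : S →L[ℂ] T) ∘L S.projectionOntoL T hST
  have hgS : ∀ s : S, -e.symm (g s) = s := fun s => by simp [g]
  have hgT : ∀ t : T, g t = t := fun t => by simp [g]
  have hker : (-(e.symm.toLinearMap ∘ₗ g.toLinearMap)).ker = g.ker := by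
    ext x
    simp
  refine ⟨g.ker, g.isClosed_ker, ?_, LinearMap.isCompl_of_proj hgT⟩
  rw [← hker]
  exact LinearMap.isCompl_of_proj hgS

theorem hasCommonComplement_of_isCompl [TopologicalSpace.SeparableSpace X] (h : IsCompl S T)
    (hdim_eq : hdim S = hdim T) : HasCommonComplement S T :=
  (nonempty_continuousLinearEquiv_of_hdim_eq hdim_eq).elim
    (hasCommonComplement_of_isCompl_of_continuousLinearEquiv h)

end GraphComplement

section Reducing

variable {𝕜 X : Type*} [RCLike 𝕜] [NormedAddCommGroup X] [InnerProductSpace 𝕜 X]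
  {L S T : Submodule 𝕜 X} [L.HasOrthogonalProjection]

theorem inf_sup_inf_orthogonal_of_forall_starProjection_mem
    (hS : ∀ x ∈ S, L.starProjection x ∈ S) : S ⊓ L ⊔ S ⊓ Lᗮ = S := by
  refine le_antisymm (sup_le inf_le_left inf_le_left) fun x hx => ?_
  rw [← Submodule.starProjection_add_starProjection_orthogonal (K := L) x]
  refine Submodule.add_mem_sup ⟨hS x hx, Submodule.starProjection_apply_mem L x⟩
    ⟨?_, Submodule.starProjection_apply_mem Lᗮ x⟩
  rw [Submodule.starProjection_orthogonal_val]
  exact sub_mem hx (hS x hx)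

theorem isCompl_map_prodEquivOfIsTopCompl (hS : ∀ x ∈ S, L.starProjection x ∈ S)
    {Z₁ : Submodule 𝕜 L} {Z₂ : Submodule 𝕜 Lᗮ}
    (h₁ : IsCompl (S.comap L.subtype) Z₁) (h₂ : IsCompl (S.comap Lᗮ.subtype) Z₂) :
    IsCompl S ((Z₁.prod Z₂).map
      (L.prodEquivOfIsTopCompl Lᗮ L.isTopCompl_orthogonal).toLinearMap) := by
  set e := (L.prodEquivOfIsTopCompl Lᗮ L.isTopCompl_orthogonal).toLinearEquiv with he
  have hprod : IsCompl ((S.comap L.subtype).prod (S.comap Lᗮ.subtype)) (Z₁.prod Z₂) := by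
    refine .of_eq ?_ ?_
    · rw [Submodule.prod_inf_prod, h₁.inf_eq_bot, h₂.inf_eq_bot, Submodule.prod_bot]
    · rw [Submodule.prod_sup_prod, h₁.sup_eq_top, h₂.sup_eq_top, Submodule.prod_top]
  have hmap : ((S.comap L.subtype).prod (S.comap Lᗮ.subtype)).map (e : L × Lᗮ →ₗ[𝕜] X) = S := by
    rw [he, Submodule.toLinearEquiv_prodEquivOfIsTopCompl, Submodule.coe_prodEquivOfIsCompl,
      LinearMap.map_coprod_prod, Submodule.map_comap_subtype, Submodule.map_comap_subtype,
      inf_comm, inf_comm Lᗮ, inf_sup_inf_orthogonal_of_forall_starProjection_mem hS]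
  have h := (Submodule.orderIsoMapComap e).isCompl hprod
  rwa [Submodule.orderIsoMapComap_apply, hmap] at h

theorem coe_starProjection_comap_subtype [S.HasOrthogonalProjection]
    [(S.comap L.subtype).HasOrthogonalProjection]
    (h : Commute L.starProjection S.starProjection) (x : L) :
    ((S.comap L.subtype).starProjection x : X) = S.starProjection x := by
  have hmem : S.starProjection (x : X) ∈ L := apply_mem_of_commute_starProjection h.symm x.2
  suffices (S.comap L.subtype).starProjection x = ⟨S.starProjection x, hmem⟩ by rw [this]
  exact Submodule.eq_starProjection_of_mem_orthogonal
    (Submodule.starProjection_apply_mem S (x : X)) fun u hu =>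
      Submodule.sub_starProjection_mem_orthogonal (x : X) u hu

theorem mem_orthogonal_of_mem_orthogonal_comap_subtype (hT : ∀ x ∈ T, L.starProjection x ∈ T)
    {x : L} (hx : x ∈ (T.comap L.subtype)ᗮ) : (x : X) ∈ Tᗮ := by
  intro t ht
  rw [← Submodule.starProjection_add_starProjection_orthogonal (K := L) t, inner_add_left,
    Submodule.inner_left_of_mem_orthogonal x.2 (Submodule.starProjection_apply_mem Lᗮ t), add_zero]
  exact hx ⟨_, Submodule.starProjection_apply_mem L t⟩ (hT t ht)

theorem comap_orthogonal_inf_orthogonal_eq_bot (hT : ∀ x ∈ T, Lᗮ.starProjection x ∈ T)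
    (h : S ⊓ Tᗮ ≤ L) : S.comap Lᗮ.subtype ⊓ (T.comap Lᗮ.subtype)ᗮ = ⊥ := by
  refine eq_bot_iff.2 fun x hx => Subtype.ext ?_
  exact Submodule.disjoint_def.1 L.orthogonal_disjoint x
    (h ⟨hx.1, mem_orthogonal_of_mem_orthogonal_comap_subtype hT hx.2⟩) x.2

end Reducing

section ReducingCommonComplement

variable {X : Type*} [NormedAddCommGroup X] [InnerProductSpace ℂ X] {L S T : Submodule ℂ X}

theorem hasCommonComplement_of_comap [L.HasOrthogonalProjection]
    (hS : ∀ x ∈ S, L.starProjection x ∈ S) (hT : ∀ x ∈ T, L.starProjection x ∈ T)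
    (h₁ : HasCommonComplement (S.comap L.subtype) (T.comap L.subtype))
    (h₂ : HasCommonComplement (S.comap Lᗮ.subtype) (T.comap Lᗮ.subtype)) :
    HasCommonComplement S T := by
  obtain ⟨Z₁, hc₁, hS₁, hT₁⟩ := h₁
  obtain ⟨Z₂, hc₂, hS₂, hT₂⟩ := h₂
  exact ⟨_, (L.prodEquivOfIsTopCompl Lᗮ L.isTopCompl_orthogonal).toHomeomorph.isClosedMap _
    (hc₁.prod hc₂), isCompl_map_prodEquivOfIsTopCompl hS hS₁ hS₂,
    isCompl_map_prodEquivOfIsTopCompl hT hT₁ hT₂⟩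

variable [CompleteSpace S] [CompleteSpace T]

theorem completeSpace_comap_subtype (S L : Submodule ℂ X) [CompleteSpace S] [CompleteSpace L] :
    CompleteSpace (S.comap L.subtype) :=
  ((IsComplete.isClosed (completeSpace_coe_iff_isComplete.1 ‹CompleteSpace S›)).preimage
    L.subtypeL.continuous).completeSpace_coe

theorem hasCommonComplement_comap_of_mul_norm_le [CompleteSpace L]
    [TopologicalSpace.SeparableSpace L] (hLS : Commute L.starProjection S.starProjection)
    (hLT : Commute L.starProjection T.starProjection) {c : ℝ} (hc : 0 < c)
    (hbelow : ∀ x ∈ L, c * ‖x‖ ≤ ‖(S.starProjection - T.starProjection) x‖)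
    (hdim_eq : hdim (S ⊓ L) = hdim (T ⊓ L)) :
    HasCommonComplement (S.comap L.subtype) (T.comap L.subtype) := by
  have := completeSpace_comap_subtype S L
  have := completeSpace_comap_subtype T L
  have hbij : Function.Bijective
      ((S.comap L.subtype).starProjection - (T.comap L.subtype).starProjection) := by
    refine bijective_of_isSelfAdjoint_of_mul_norm_le
      ((isSelfAdjoint_starProjection _).sub (isSelfAdjoint_starProjection _)) hc fun x => ?_
    have h := hbelow x x.2
    rwa [sub_apply, ← coe_starProjection_comap_subtype hLS,
      ← coe_starProjection_comap_subtype hLT] at h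
  refine hasCommonComplement_of_isCompl (isCompl_of_bijective_starProjection_sub hbij) ?_
  rw [hdim_comap_subtype, hdim_comap_subtype, hdim_eq]

theorem hasCommonComplement_comap_orthogonal [CompleteSpace X] [L.HasOrthogonalProjection]
    (hLS : Commute L.starProjection S.starProjection)
    (hLT : Commute L.starProjection T.starProjection) (h₁ : S ⊓ Tᗮ ≤ L) (h₂ : Sᗮ ⊓ T ≤ L) :
    HasCommonComplement (S.comap Lᗮ.subtype) (T.comap Lᗮ.subtype) := by
  have := completeSpace_comap_subtype S Lᗮ
  have := completeSpace_comap_subtype T Lᗮ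
  have hcomm {V : Submodule ℂ X} [V.HasOrthogonalProjection]
      (h : Commute L.starProjection V.starProjection) :
      Commute Lᗮ.starProjection V.starProjection := by
    rw [Submodule.starProjection_orthogonal']
    exact (Commute.one_left _).sub_left h
  refine hasCommonComplement_of_inf_orthogonal_eq_bot (comap_orthogonal_inf_orthogonal_eq_bot
    (fun _ => apply_mem_of_commute_starProjection (hcomm hLT)) h₁) ?_
  rw [inf_comm] at h₂ ⊢
  exact comap_orthogonal_inf_orthogonal_eq_bot
    (fun _ => apply_mem_of_commute_starProjection (hcomm hLS)) h₂

end ReducingCommonComplement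

section ProjectionDifference

variable {𝕜 X : Type*} [RCLike 𝕜] [NormedAddCommGroup X] [InnerProductSpace 𝕜 X]
  {S T : Submodule 𝕜 X} [S.HasOrthogonalProjection] [T.HasOrthogonalProjection]

theorem starProjection_mul_starProjection_sub :
    S.starProjection * (S.starProjection - T.starProjection)
      = S.starProjection * Tᗮ.starProjection := by
  rw [Submodule.starProjection_orthogonal', mul_sub, mul_sub,
    S.isIdempotentElem_starProjection.eq, mul_one]

theorem starProjection_sub_apply_eq_self_iff {x : X} :
    (S.starProjection - T.starProjection) x = x ↔ x ∈ S ⊓ Tᗮ := by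
  rw [sub_apply]
  constructor
  · intro h
    have hre (V : Submodule 𝕜 X) [V.HasOrthogonalProjection] :
        ‖V.starProjection x‖ ^ 2 = RCLike.re (inner 𝕜 (V.starProjection x) x) :=
      (V.re_inner_starProjection_eq_normSq x).symm
    have hsq : ‖Sᗮ.starProjection x‖ ^ 2 + ‖T.starProjection x‖ ^ 2 = 0 := by
      rw [hre, hre, ← map_add, ← inner_add_left, Submodule.starProjection_orthogonal_val,
        sub_add, h, sub_self, inner_zero_left, map_zero]
    obtain ⟨hS, hT⟩ := (add_eq_zero_iff_of_nonneg (sq_nonneg _) (sq_nonneg _)).1 hsq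
    rw [sq_eq_zero_iff, norm_eq_zero, Submodule.starProjection_apply_eq_zero_iff] at hS hT
    exact ⟨Submodule.orthogonal_orthogonal S ▸ hS, hT⟩
  · rintro ⟨hS, hT⟩
    rw [Submodule.starProjection_eq_self_iff.2 hS,
      (Submodule.starProjection_apply_eq_zero_iff _).2 hT, sub_zero]

theorem ker_starProjection_sub_sub_one :
    (S.starProjection - T.starProjection - 1 : X →L[𝕜] X).ker = S ⊓ Tᗮ := by
  ext x
  rw [← starProjection_sub_apply_eq_self_iff, ← sub_eq_zero]
  rfl

theorem ker_starProjection_sub_add_one :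
    (S.starProjection - T.starProjection + 1 : X →L[𝕜] X).ker = Sᗮ ⊓ T := by
  rw [inf_comm, ← ker_starProjection_sub_sub_one, ← neg_sub S.starProjection, ← neg_add']
  ext x
  exact neg_eq_zero.symm

theorem starProjection_apply_eq_zero_of_mem_orthogonal {x : X} (hx : x ∈ (Sᗮ ⊓ T)ᗮ)
    (h : S.starProjection (T.starProjection x) = 0) : T.starProjection x = 0 := by
  have hmem : T.starProjection x ∈ Sᗮ ⊓ T :=
    ⟨(Submodule.starProjection_apply_eq_zero_iff _).1 h, Submodule.starProjection_apply_mem T _⟩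
  have hsq := Submodule.re_inner_starProjection_eq_normSq (K := T) (𝕜 := 𝕜) x
  rw [hx _ hmem, map_zero] at hsq
  exact norm_eq_zero.1 (sq_eq_zero_iff.1 hsq.symm)

theorem finiteDimensional_of_finiteDimensional_inf {L W : Submodule 𝕜 X}
    [L.HasOrthogonalProjection] (hLS : Commute L.starProjection S.starProjection)
    (hLT : Commute L.starProjection T.starProjection)
    (hinj : ∀ x ∈ L, (S.starProjection - T.starProjection) x = 0 → x = 0)
    (hWL : W ≤ L) (hW : W ≤ (Sᗮ ⊓ T)ᗮ) [FiniteDimensional 𝕜 (S ⊓ L : Submodule 𝕜 X)] :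
    FiniteDimensional 𝕜 W := by
  let f : L →ₗ[𝕜] (S ⊓ L : Submodule 𝕜 X) := S.starProjection.toLinearMap.restrict fun x hx =>
    ⟨Submodule.starProjection_apply_mem S x, apply_mem_of_commute_starProjection hLS.symm hx⟩
  let g : L →ₗ[𝕜] L := T.starProjection.toLinearMap.restrict
    fun x hx => apply_mem_of_commute_starProjection hLT.symm hx
  refine FiniteDimensional.of_injective ((f.prod (f ∘ₗ g)) ∘ₗ Submodule.inclusion hWL)
    ((injective_iff_map_eq_zero _).2 fun x hx => ?_)
  obtain ⟨hf, hfg⟩ := Prod.ext_iff.1 hx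
  have hS : S.starProjection (x : X) = 0 := congrArg Subtype.val hf
  have hT : T.starProjection (x : X) = 0 :=
    starProjection_apply_eq_zero_of_mem_orthogonal (hW x.2) (congrArg Subtype.val hfg)
  exact Subtype.ext (hinj x (hWL x.2) (by rw [sub_apply, hS, hT, sub_zero]))

end ProjectionDifference

section Existence

variable {X : Type*} [NormedAddCommGroup X] [InnerProductSpace ℂ X] [CompleteSpace X]
  {ε : ℝ}

theorem absGeSpace_sub_comm (A B : X →L[ℂ] X) (ε : ℝ) :
    absGeSpace (A - B) ε = absGeSpace (B - A) ε := by
  rw [absGeSpace, absGeSpace, ← neg_sub B A, neg_sq]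

section HasOrthogonalProjection

variable (S T : Submodule ℂ X) [S.HasOrthogonalProjection] [T.HasOrthogonalProjection]

theorem isSelfAdjoint_starProjection_sub : IsSelfAdjoint (S.starProjection - T.starProjection) :=
  (isSelfAdjoint_starProjection S).sub (isSelfAdjoint_starProjection T)

theorem commute_starProjection_absGeSpace_sub_left :
    Commute (absGeSpace (S.starProjection - T.starProjection) ε).starProjection
      S.starProjection :=
  commute_starProjection_absGeSpace (isSelfAdjoint_starProjection S)
    (commute_sub_sq_left S.isIdempotentElem_starProjection T.isIdempotentElem_starProjection)

theorem commute_starProjection_absGeSpace_sub_right :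
    Commute (absGeSpace (S.starProjection - T.starProjection) ε).starProjection
      T.starProjection :=
  commute_starProjection_absGeSpace (isSelfAdjoint_starProjection T)
    (commute_sub_sq_right S.isIdempotentElem_starProjection T.isIdempotentElem_starProjection)

theorem inf_orthogonal_le_absGeSpace (hε : 0 ≤ ε) (hε₁ : ε ≤ 1) :
    S ⊓ Tᗮ ≤ absGeSpace (S.starProjection - T.starProjection) ε := by
  intro x hx
  refine mem_absGeSpace_of_apply_eq_smul (isSelfAdjoint_starProjection_sub S T) (r := 1)
    (pow_le_pow_left₀ hε hε₁ 2) ?_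
  rw [starProjection_sub_apply_eq_self_iff.2 hx, Complex.ofReal_one, one_smul]

theorem orthogonal_inf_le_absGeSpace (hε : 0 ≤ ε) (hε₁ : ε ≤ 1) :
    Sᗮ ⊓ T ≤ absGeSpace (S.starProjection - T.starProjection) ε := by
  rw [inf_comm, absGeSpace_sub_comm]
  exact inf_orthogonal_le_absGeSpace T S hε hε₁

theorem inf_absGeSpace_one :
    S ⊓ absGeSpace (S.starProjection - T.starProjection) 1 = S ⊓ Tᗮ := by
  refine le_antisymm (fun x ⟨hS, hx⟩ => ⟨hS, ?_⟩)
    (le_inf inf_le_left (inf_orthogonal_le_absGeSpace S T zero_le_one le_rfl))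
  have hnorm := mul_norm_le_norm_apply_of_mem_absGeSpace (isSelfAdjoint_starProjection_sub S T) hx
  rw [one_mul, sub_apply, Submodule.starProjection_eq_self_iff.2 hS,
    ← Submodule.starProjection_orthogonal_val] at hnorm
  exact (Submodule.mem_iff_norm_starProjection Tᗮ x).2
    ((Submodule.norm_starProjection_apply_le _ _).antisymm hnorm)

variable {S T}

theorem not_finiteDimensional_inf_absGeSpace {W : Submodule ℂ X} (hε : 0 < ε)
    (hW : W ≤ (Sᗮ ⊓ T)ᗮ) (h : ¬ FiniteDimensional ℂ
      (W ⊓ absGeSpace (S.starProjection - T.starProjection) ε : Submodule ℂ X)) :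
    ¬ FiniteDimensional ℂ
      (S ⊓ absGeSpace (S.starProjection - T.starProjection) ε : Submodule ℂ X) := by
  refine fun _ => h (finiteDimensional_of_finiteDimensional_inf
    (commute_starProjection_absGeSpace_sub_left S T)
    (commute_starProjection_absGeSpace_sub_right S T) (fun x hx hzero => ?_)
    inf_le_right (inf_le_left.trans hW))
  have hnorm := mul_norm_le_norm_apply_of_mem_absGeSpace (isSelfAdjoint_starProjection_sub S T) hx
  rw [hzero, norm_zero] at hnorm
  exact norm_le_zero_iff.1 (nonpos_of_mul_nonpos_right hnorm hε)

theorem exists_not_finiteDimensional_inf_absGeSpace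
    (h : ¬ IsCompactOperator ((S.starProjection - T.starProjection) ∘L
      (S ⊓ Tᗮ ⊔ Sᗮ ⊓ T)ᗮ.subtypeL)) :
    ∃ ε : ℝ, 0 < ε ∧ ε < 1 ∧ ¬ FiniteDimensional ℂ ((S ⊓ Tᗮ ⊔ Sᗮ ⊓ T)ᗮ ⊓
      absGeSpace (S.starProjection - T.starProjection) ε : Submodule ℂ X) := by
  contrapose! h
  refine isCompactOperator_comp_subtypeL_of_finiteDimensional_inf_absGeSpace
    (isSelfAdjoint_starProjection_sub S T) h fun ε hε hε₁ x hx => ?_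
  exact starProjection_mem_orthogonal_of_le (sup_le (inf_orthogonal_le_absGeSpace S T hε.le hε₁.le)
    (orthogonal_inf_le_absGeSpace S T hε.le hε₁.le)) hx

end HasOrthogonalProjection

variable [TopologicalSpace.SeparableSpace X] {S T : Submodule ℂ X} [CompleteSpace S]
  [CompleteSpace T]

theorem hasCommonComplement_of_hdim_inf_absGeSpace_eq (hε : 0 < ε) (hε₁ : ε ≤ 1)
    (h : hdim (S ⊓ absGeSpace (S.starProjection - T.starProjection) ε)
      = hdim (T ⊓ absGeSpace (S.starProjection - T.starProjection) ε)) :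
    HasCommonComplement S T := by
  have : SecondCountableTopology X := UniformSpace.secondCountable_of_separable X
  have hLS := commute_starProjection_absGeSpace_sub_left S T (ε := ε)
  have hLT := commute_starProjection_absGeSpace_sub_right S T (ε := ε)
  exact hasCommonComplement_of_comap (fun _ => apply_mem_of_commute_starProjection hLS)
    (fun _ => apply_mem_of_commute_starProjection hLT)
    (hasCommonComplement_comap_of_mul_norm_le hLS hLT hε (fun _ =>
      mul_norm_le_norm_apply_of_mem_absGeSpace (isSelfAdjoint_starProjection_sub S T)) h)
    (hasCommonComplement_comap_orthogonal hLS hLT (inf_orthogonal_le_absGeSpace S T hε.le hε₁)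
      (orthogonal_inf_le_absGeSpace S T hε.le hε₁))

theorem hasCommonComplement_of_hdim_eq (h : hdim (S ⊓ Tᗮ) = hdim (Sᗮ ⊓ T)) :
    HasCommonComplement S T := by
  refine hasCommonComplement_of_hdim_inf_absGeSpace_eq one_pos le_rfl ?_
  rw [inf_absGeSpace_one, absGeSpace_sub_comm, inf_absGeSpace_one, h, inf_comm]

theorem hasCommonComplement_of_not_isCompactOperator
    (h : ¬ IsCompactOperator ((S.starProjection - T.starProjection) ∘L
      (S ⊓ Tᗮ ⊔ Sᗮ ⊓ T)ᗮ.subtypeL)) : HasCommonComplement S T := by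
  obtain ⟨ε, hε, hε₁, hW⟩ := exists_not_finiteDimensional_inf_absGeSpace h
  have hS := not_finiteDimensional_inf_absGeSpace hε (Submodule.orthogonal_le le_sup_right) hW
  refine hasCommonComplement_of_hdim_inf_absGeSpace_eq hε hε₁.le ?_
  rw [absGeSpace_sub_comm] at hW
  have hT := not_finiteDimensional_inf_absGeSpace hε
    (Submodule.orthogonal_le ((inf_comm _ _).trans_le le_sup_left)) hW
  rw [absGeSpace_sub_comm] at hT
  rw [hdim_eq_top_iff.2 hS, hdim_eq_top_iff.2 hT]

end Existence

section CompactProducts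

open ContinuousLinearMap

variable {𝕜 X : Type*} [RCLike 𝕜] [NormedAddCommGroup X] [InnerProductSpace 𝕜 X]
  {S T : Submodule 𝕜 X} [S.HasOrthogonalProjection] [T.HasOrthogonalProjection]

theorem isCompactOperator_of_comp_subtypeL_of_comp_subtypeL_orthogonal {Y : Type*}
    [NormedAddCommGroup Y] [NormedSpace 𝕜 Y] {V : Submodule 𝕜 X} [V.HasOrthogonalProjection]
    {f : X →L[𝕜] Y} (h₁ : IsCompactOperator (f ∘L V.subtypeL))
    (h₂ : IsCompactOperator (f ∘L Vᗮ.subtypeL)) : IsCompactOperator f := by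
  have hf : f = (f ∘L V.subtypeL) ∘L V.orthogonalProjectionOnto
      + (f ∘L Vᗮ.subtypeL) ∘L Vᗮ.orthogonalProjectionOnto := by
    ext x
    conv_lhs => rw [← Submodule.starProjection_add_starProjection_orthogonal (K := V) x, map_add]
    rfl
  rw [hf]
  exact (h₁.comp_clm _).add (h₂.comp_clm _)

theorem starProjection_mul_starProjection_orthogonal_apply_mem {x : X}
    (hx : x ∈ S ⊓ Tᗮ ⊔ Sᗮ ⊓ T) : (S.starProjection * Tᗮ.starProjection) x ∈ S ⊓ Tᗮ := by
  obtain ⟨y, hy, z, hz, rfl⟩ := Submodule.mem_sup.1 hx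
  have hTz : Tᗮ.starProjection z = 0 :=
    (Submodule.starProjection_apply_eq_zero_iff _).2 (T.le_orthogonal_orthogonal hz.2)
  rwa [mul_apply_eq_comp, map_add, hTz, add_zero, Submodule.starProjection_eq_self_iff.2 hy.2,
    Submodule.starProjection_eq_self_iff.2 hy.1]

variable [CompleteSpace X]

theorem isCompactOperator_starProjection_mul [FiniteDimensional 𝕜 (S ⊓ Tᗮ : Submodule 𝕜 X)]
    (h : IsCompactOperator ((S.starProjection - T.starProjection) ∘L
      (S ⊓ Tᗮ ⊔ Sᗮ ⊓ T)ᗮ.subtypeL)) :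
    IsCompactOperator (S.starProjection * Tᗮ.starProjection) := by
  have hT : IsClosed (T : Set X) := T.orthogonal_orthogonal ▸ Submodule.isClosed_orthogonal _
  have : CompleteSpace (S ⊓ Tᗮ ⊔ Sᗮ ⊓ T : Submodule 𝕜 X) := by
    rw [sup_comm]
    exact (Submodule.isClosed_sup_finiteDimensional _ _
      ((Submodule.isClosed_orthogonal S).inter hT)).completeSpace_coe
  refine isCompactOperator_of_comp_subtypeL_of_comp_subtypeL_orthogonal
    (V := S ⊓ Tᗮ ⊔ Sᗮ ⊓ T) ?_ ?_
  · exact isCompactOperator_comp_of_finiteDimensional (S ⊓ Tᗮ).subtypeL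
      (((S.starProjection * Tᗮ.starProjection) ∘L Submodule.subtypeL _).codRestrict _ fun x =>
        starProjection_mul_starProjection_orthogonal_apply_mem x.2)
  · rw [← starProjection_mul_starProjection_sub]
    exact h.clm_comp S.starProjection

end CompactProducts

section HDimObstruction

variable {X : Type*} [NormedAddCommGroup X] [InnerProductSpace ℂ X] [CompleteSpace X]
  {S T : Submodule ℂ X} [S.HasOrthogonalProjection] [T.HasOrthogonalProjection]

theorem isCompactOperator_starProjection_mul_or (hne : hdim (S ⊓ Tᗮ) ≠ hdim (Sᗮ ⊓ T))
    (h : IsCompactOperator ((S.starProjection - T.starProjection) ∘L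
      (S ⊓ Tᗮ ⊔ Sᗮ ⊓ T)ᗮ.subtypeL)) :
    IsCompactOperator (S.starProjection * Tᗮ.starProjection) ∨
      IsCompactOperator (T.starProjection * Sᗮ.starProjection) := by
  by_cases hST : FiniteDimensional ℂ (S ⊓ Tᗮ : Submodule ℂ X)
  · exact .inl (isCompactOperator_starProjection_mul h)
  · have hTS : FiniteDimensional ℂ (T ⊓ Sᗮ : Submodule ℂ X) := by
      contrapose! hne
      rw [inf_comm Sᗮ, hdim_eq_top_iff.2 hST, hdim_eq_top_iff.2 hne]
    refine .inr (isCompactOperator_starProjection_mul ?_)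
    rw [sup_comm, inf_comm Tᗮ, inf_comm T, ← neg_sub, ContinuousLinearMap.neg_comp]
    exact h.neg

end HDimObstruction

section ProjectionOnto

variable {𝕜 X : Type*} [RCLike 𝕜] [NormedAddCommGroup X] [InnerProductSpace 𝕜 X]

theorem ker_orthogonalProjectionOnto_comp_subtypeL (S T : Submodule 𝕜 X)
    [T.HasOrthogonalProjection] :
    (T.orthogonalProjectionOnto ∘L S.subtypeL).ker = Tᗮ.comap S.subtype := by
  ext s
  exact T.orthogonalProjectionOnto_eq_zero_iff

theorem orthogonal_range_orthogonalProjectionOnto_comp_subtypeL [CompleteSpace X]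
    (S T : Submodule 𝕜 X) [CompleteSpace S] [CompleteSpace T] :
    (T.orthogonalProjectionOnto ∘L S.subtypeL).rangeᗮ = Sᗮ.comap T.subtype := by
  rw [ContinuousLinearMap.orthogonal_range, ContinuousLinearMap.adjoint_comp,
    Submodule.adjoint_subtypeL, Submodule.adjoint_orthogonalProjectionOnto,
    ker_orthogonalProjectionOnto_comp_subtypeL]

end ProjectionOnto

section Obstruction

variable {X : Type*} [NormedAddCommGroup X] [InnerProductSpace ℂ X] {S T : Submodule ℂ X}

theorem HasCommonComplement.symm (h : HasCommonComplement S T) : HasCommonComplement T S :=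
  h.imp fun _ hZ => ⟨hZ.1, hZ.2.2, hZ.2.1⟩

variable [CompleteSpace X] [CompleteSpace S] [CompleteSpace T]

theorem HasCommonComplement.exists_continuousLinearEquiv (h : HasCommonComplement S T) :
    ∃ (q : X →L[ℂ] T) (e : S ≃L[ℂ] T), (∀ t : T, q t = t) ∧ (e : S →L[ℂ] T) = q ∘L S.subtypeL := by
  obtain ⟨Z, hZ, hSZ, hTZ⟩ := h
  have hT : IsClosed (T : Set X) :=
    IsComplete.isClosed (completeSpace_coe_iff_isComplete.1 ‹CompleteSpace T›)
  have htop := Submodule.IsCompl.isTopCompl_of_isClosed hTZ hT hZ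
  set q := T.projectionOntoL Z htop
  have hinj : Function.Injective (q.toLinearMap.domRestrict S) := by
    rw [LinearMap.injective_domRestrict_iff, Submodule.ker_projectionOntoL]
    exact hSZ.disjoint
  have hsurj : Function.Surjective (q.toLinearMap.domRestrict S) := by
    rw [LinearMap.surjective_domRestrict_iff (Submodule.projectionOntoL_surjective htop),
      Submodule.ker_projectionOntoL]
    exact hSZ.codisjoint
  exact ⟨q, .ofBijective (q ∘L S.subtypeL) (LinearMap.ker_eq_bot.2 hinj)
    (LinearMap.range_eq_top.2 hsurj), Submodule.projectionOntoL_apply_left htop, by ext; rfl⟩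

theorem HasCommonComplement.hdim_eq (h : HasCommonComplement S T)
    (hcomp : IsCompactOperator (S.starProjection * Tᗮ.starProjection)) :
    hdim (S ⊓ Tᗮ) = hdim (Sᗮ ⊓ T) := by
  obtain ⟨q, e, hqT, he⟩ := h.exists_continuousLinearEquiv
  have hadj : IsCompactOperator (Tᗮ.starProjection * S.starProjection) := by
    have hstar := isCompactOperator_adjoint hcomp
    rwa [← ContinuousLinearMap.star_eq_adjoint, star_mul,
      (isSelfAdjoint_starProjection S).star_eq, (isSelfAdjoint_starProjection Tᗮ).star_eq] at hstar
  have hK : IsCompactOperator (q ∘L (Tᗮ.starProjection * S.starProjection) ∘L S.subtypeL) :=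
    (hadj.comp_clm S.subtypeL).clm_comp q
  have hsub : (e : S →L[ℂ] T) - q ∘L (Tᗮ.starProjection * S.starProjection) ∘L S.subtypeL
      = T.orthogonalProjectionOnto ∘L S.subtypeL := by
    ext s
    have hs : q (T.starProjection (s : X)) = T.orthogonalProjectionOnto (s : X) := hqT _
    simp [he, hs]
  have hrank := rank_ker_equiv_sub_eq e hK
  rw [hsub, ker_orthogonalProjectionOnto_comp_subtypeL,
    orthogonal_range_orthogonalProjectionOnto_comp_subtypeL] at hrank
  rw [inf_comm, ← hdim_comap_subtype, ← hdim_comap_subtype, hdim, hdim, hrank]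

theorem HasCommonComplement.hdim_eq_of_or (h : HasCommonComplement S T)
    (hcomp : IsCompactOperator (S.starProjection * Tᗮ.starProjection) ∨
      IsCompactOperator (T.starProjection * Sᗮ.starProjection)) :
    hdim (S ⊓ Tᗮ) = hdim (Sᗮ ⊓ T) := by
  rcases hcomp with hcomp | hcomp
  · exact h.hdim_eq hcomp
  · rw [inf_comm, ← h.symm.hdim_eq hcomp, inf_comm]

end Obstruction

theorem mainTheorem5 {H : Type*} [NormedAddCommGroup H] [InnerProductSpace ℂ H]
    [CompleteSpace H] [TopologicalSpace.SeparableSpace H] (S T : ClosedSubmodule ℂ H) :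
    (¬ HasCommonComplement S.toSubmodule T.toSubmodule ↔
      hdim (projDiff S T - 1).ker ≠ hdim (projDiff S T + 1).ker ∧
      IsCompactOperator (fun x : eigenCompl (projDiff S T) => projDiff S T (x : H))) ∧
    (¬ HasCommonComplement S.toSubmodule T.toSubmodule ↔
      hdim (S.toSubmodule ⊓ T.toSubmoduleᗮ) ≠ hdim (S.toSubmoduleᗮ ⊓ T.toSubmodule) ∧
      (IsCompactOperator (orthProj S * orthProj Tᗮ) ∨
        IsCompactOperator (orthProj T * orthProj Sᗮ))) := by
  have : CompleteSpace S.toSubmodule := S.isClosed.completeSpace_coe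
  have : CompleteSpace T.toSubmodule := T.isClosed.completeSpace_coe
  have hker₁ : (projDiff S T - 1).ker = S.toSubmodule ⊓ T.toSubmoduleᗮ :=
    ker_starProjection_sub_sub_one
  have hker₂ : (projDiff S T + 1).ker = S.toSubmoduleᗮ ⊓ T.toSubmodule :=
    ker_starProjection_sub_add_one
  rw [eigenCompl, hker₁, hker₂]
  have hdim_ne (h : ¬ HasCommonComplement S.toSubmodule T.toSubmodule) :
      hdim (S.toSubmodule ⊓ T.toSubmoduleᗮ) ≠ hdim (S.toSubmoduleᗮ ⊓ T.toSubmodule) :=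
    mt hasCommonComplement_of_hdim_eq h
  have hcompact (h : ¬ HasCommonComplement S.toSubmodule T.toSubmodule) :=
    not_not.1 (mt hasCommonComplement_of_not_isCompactOperator h)
  exact ⟨⟨fun h => ⟨hdim_ne h, hcompact h⟩, fun ⟨hne, hc⟩ h =>
      hne (h.hdim_eq_of_or (isCompactOperator_starProjection_mul_or hne hc))⟩,
    ⟨fun h => ⟨hdim_ne h, isCompactOperator_starProjection_mul_or (hdim_ne h) (hcompact h)⟩,
      fun ⟨hne, hc⟩ h => hne (h.hdim_eq_of_or hc)⟩⟩
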